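/- **Theorem 1.1.** Work over $\mathbb C$. Let $V$ be a finite-dimensional vector space, let $\mathbb PV$ be the projective space of one-dimensional subspaces of $V^*$ (so that $V$ is the space of linear forms on $\mathbb PV$), and let $X\subseteq\mathbb PV$ be an irreducible projective variety that is nondegenerate, i.e. its linear span is $\mathbb PV$. Let $k\ge 0$ be an integer, let $V_1,\dots,V_{2k+2}$ be finite-dimensional vector spaces, and let $T:V_1\otimes\cdots\otimes V_{2k+2}\to V$ be a linear map that is *$X$-multiplicative*, i.e. - $T(v_1\otimes\cdots\otimes v_{2k+2})\ne 0$ whenever $0\neq v_i\in V_i$ for all $i$ ($T$ is $1$-generic), and - for a general point $\widehat z$ of the affine cone $\widehat X\subseteq V^*$ of $X$, the tensor $T^*(\widehat z)\in V_1^*\otimes\cdots\otimes V_{2k+2}^*$ is either zero or of the form $f_1\otimes\cdots\otimes f_{2k+2}$ with $0\ne f_i\in V_i^*$ ($T$ is $X$-simple). For an integer $q\ge1$ let $$b_{q+1}(T):\textstyle\bigwedge^{q+1}V_1\otimes\cdots\otimes\bigwedge^{q+1}V_{2k+2}\longrightarrow S^{q+1}(V_1\otimes\cdots\otimes V_{2k+2})\xrightarrow{\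 S^{q+1}T\ } S^{q+1}V$$ be the composition whose first map is the canonical one, $$\bigotimes_{i}\,(v_{i,0}\wedge\cdots\wedge v_{i,q})\ \longmapsto\ \frac1{(q+1)!}\sum_{\sigma_1,\dots,\sigma_{2k+2}\in\mathfrak S_{q+1}}\Big(\prod_i\operatorname{sgn}\sigma_i\Big)\prod_{j=0}^{q}\big(v_{1,\sigma_1(j)}\otimes\cdots\otimes v_{2k+2,\sigma_{2k+2}(j)}\big).$$ For a smooth point $z$ of $X$ and $n=\dim X$, let $\phi:(\mathbb C^n,0)\to(\widehat X,\widehat z)\subseteq(V^*,\widehat z)$, where $\widehat z\neq0$ lies over $z$, be a holomorphic lifting of a local parametrization of $X$ at $z$, and let $\mathbb T^k_zX\subseteq\mathbb PV$ be the linear subspace whose affine cone is spanned by all partial derivatives of $\phi$ at $0$ of order $\le k$ (the $k$-osculating space). Let $$\sigma_q\tau^kX=\overline{\bigcup_{z_1,\dots,z_q}\langle\mathbb T^k_{z_1}X,\dots,\mathbb T^k_{z_q}X\rangle}\subseteq\mathbb PV$$ be the Zariski closure of the union over all $q$-tuples of smooth points of $X$ for which $\dim\langle\mathbb T^k_{z_1}X,\dots,\mathbb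 T^k_{z_q}X\rangle$ attains its maximum. Then for every integer $q\ge 1$ the image of $b_{q+1}(T)$ lies in $I(\sigma_q\tau^kX)_{q+1}$, the space of forms of degree $q+1$ vanishing on $\sigma_q\tau^kX$. Moreover, $b_{q+1}(T)\ne0$ whenever $\dim V_i\ge q+1$ for all $1\le i\le 2k+2$. -/

import Mathlib

open scoped TensorProduct Topology LinearAlgebra.Projectivization

noncomputable section

namespace SecOsc

/-! ### Projective space, homogeneous forms and the Zariski topology -/

section Projective

variable {V : Type*} [AddCommGroup V] [Module ℂ V]

/-- The projective space `ℙV` of one-dimensional subspaces of `V*`, so that `V` is the space of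
linear forms on it. -/
abbrev PP (V : Type*) [AddCommGroup V] [Module ℂ V] : Type _ := ℙ ℂ (Module.Dual ℂ V)

/-- The value of a polynomial function `f ∈ S*V` at a vector `x ∈ V*`. -/
def evalAt (x : Module.Dual ℂ V) : SymmetricAlgebra ℂ V →ₐ[ℂ] ℂ := SymmetricAlgebra.lift x

/-- The space `S^d V` of forms of degree `d`, inside the symmetric algebra `S*V`. -/
def forms (V : Type*) [AddCommGroup V] [Module ℂ V] (d : ℕ) :
    Submodule ℂ (SymmetricAlgebra ℂ V) :=
  LinearMap.range (SymmetricAlgebra.ι ℂ V) ^ d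

/-- The Zariski topology on `ℙV`: its basic open sets are the nonvanishing loci of forms. -/
instance zariskiTopology : TopologicalSpace (PP V) :=
  TopologicalSpace.generateFrom
    {U | ∃ d : ℕ, ∃ f ∈ forms V d, U = {p : PP V | evalAt p.rep f ≠ 0}}

/-- The affine cone in `V*` over a subset of `ℙV` (the origin is included). -/
def affineCone (X : Set (PP V)) : Set (Module.Dual ℂ V) :=
  {x | ∀ hx : x ≠ 0, Projectivization.mk ℂ x hx ∈ X}

/-- The ideal `I(X)` of all elements of `S*V` that vanish on the affine cone over `X`. -/
def vanishingIdeal (X : Set (PP V)) : Ideal (SymmetricAlgebra ℂ V) where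
  carrier := {f | ∀ x ∈ affineCone X, evalAt x f = 0}
  zero_mem' := fun x _ => map_zero _
  add_mem' := fun {f g} hf hg x hx => by rw [map_add, hf x hx, hg x hx, add_zero]
  smul_mem' := fun c f hf x hx => by rw [smul_eq_mul, map_mul, hf x hx, mul_zero]

/-- The space `I(X)_d` of forms of degree `d` in the ideal of `X`. -/
def idealDegree (X : Set (PP V)) (d : ℕ) : Submodule ℂ (SymmetricAlgebra ℂ V) :=
  (vanishingIdeal X).restrictScalars ℂ ⊓ forms V d

/-- A projective variety: a Zariski closed, irreducible (in particular nonempty) subset. -/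
def IsProjectiveVariety (X : Set (PP V)) : Prop :=
  IsClosed X ∧ IsIrreducible X

/-- `X` is nondegenerate: its linear span is all of `ℙV`. -/
def IsNondegenerate (X : Set (PP V)) : Prop :=
  Submodule.span ℂ (affineCone X) = ⊤

/-! ### Smooth points -/

/-- The value of `f ∈ S*V` at `x + ε w` with `ε² = 0`, which is `f(x) + ε · (d_x f)(w)`. -/
def evalEps (x w : Module.Dual ℂ V) : SymmetricAlgebra ℂ V →ₐ[ℂ] TrivSqZeroExt ℂ ℂ :=
  SymmetricAlgebra.lift
    ((TrivSqZeroExt.inlAlgHom ℂ ℂ ℂ).toLinearMap ∘ₗ x + TrivSqZeroExt.inrHom ℂ ℂ ∘ₗ w)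

/-- The differential `(d_x f)(w)` of `f ∈ S*V` at `x ∈ V*` in the direction `w ∈ V*`. -/
def differential (x : Module.Dual ℂ V) (f : SymmetricAlgebra ℂ V) (w : Module.Dual ℂ V) : ℂ :=
  (evalEps x w f).snd

lemma evalEps_fst (x w : Module.Dual ℂ V) (f : SymmetricAlgebra ℂ V) :
    (evalEps x w f).fst = evalAt x f := by
  have h : (TrivSqZeroExt.fstHom ℂ ℂ ℂ).comp (evalEps x w) = evalAt x := by
    apply SymmetricAlgebra.algHom_ext
    ext v
    simp [evalEps, evalAt]
  exact congrArg (fun F => F f) h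

lemma differential_algebraMap (x w : Module.Dual ℂ V) (c : ℂ) :
    differential x (algebraMap ℂ _ c) w = 0 := by
  simp [differential, TrivSqZeroExt.algebraMap_eq_inl]

lemma differential_ι (x w : Module.Dual ℂ V) (v : V) :
    differential x (SymmetricAlgebra.ι ℂ V v) w = w v := by
  simp [differential, evalEps]

lemma differential_add (x w : Module.Dual ℂ V) (f g : SymmetricAlgebra ℂ V) :
    differential x (f + g) w = differential x f w + differential x g w := by
  simp [differential]

lemma differential_mul (x w : Module.Dual ℂ V) (f g : SymmetricAlgebra ℂ V) :
    differential x (f * g) w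
      = evalAt x f * differential x g w + evalAt x g * differential x f w := by
  simp [differential, evalEps_fst, mul_comm]

lemma differential_add_right (x w w' : Module.Dual ℂ V) (f : SymmetricAlgebra ℂ V) :
    differential x f (w + w') = differential x f w + differential x f w' := by
  induction f using SymmetricAlgebra.induction with
  | algebraMap r => simp [differential_algebraMap]
  | ι v => simp [differential_ι]
  | mul a b ha hb => rw [differential_mul, differential_mul, differential_mul, ha, hb]; ring
  | add a b ha hb => rw [differential_add, differential_add, differential_add, ha, hb]; ring

lemma differential_smul_right (x w : Module.Dual ℂ V) (c : ℂ) (f : SymmetricAlgebra ℂ V) :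
    differential x f (c • w) = c * differential x f w := by
  induction f using SymmetricAlgebra.induction with
  | algebraMap r => simp [differential_algebraMap]
  | ι v => simp [differential_ι]
  | mul a b ha hb => rw [differential_mul, differential_mul, ha, hb]; ring
  | add a b ha hb => rw [differential_add, differential_add, ha, hb]; ring

/-- The Zariski tangent space at `x` of the affine cone over `X`: the common kernel in `V*` of the
differentials at `x` of the elements of `I(X)`. -/
def tangentSpace (X : Set (PP V)) (x : Module.Dual ℂ V) : Submodule ℂ (Module.Dual ℂ V) where
  carrier := {w | ∀ f ∈ vanishingIdeal X, differential x f w = 0}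
  zero_mem' := fun f _ => by
    have h := differential_smul_right x 0 0 f
    rwa [zero_smul, zero_mul] at h
  add_mem' := fun {w w'} hw hw' f hf => by
    rw [differential_add_right, hw f hf, hw' f hf, add_zero]
  smul_mem' := fun c w hw f hf => by rw [differential_smul_right, hw f hf, mul_zero]

/-- The smooth locus of a projective variety `X`: the points at which the tangent space of the
affine cone has the dimension `dim X + 1` of the cone. The dimension of `X` is its Krull dimension
in the Zariski topology. -/
def smoothLocus (X : Set (PP V)) : Set (PP V) :=
  {z | z ∈ X ∧
    ((Module.finrank ℂ (tangentSpace X z.rep) : ℕ) : WithBot ℕ∞) = topologicalKrullDim X + 1}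

/-! ### Osculating spaces and the varieties `σ_q τ^k X` -/

/-- `φ` is (a representative of the germ at `0` of) a holomorphic lifting
`(ℂⁿ, 0) → (X̂, ẑ) ⊆ (V*, ẑ)` of a local parametrization of `X` at `z`, where `n = dim X`.
Holomorphy is tested on the coordinates `v ∈ V` of `V*`. The last field says that the differential
at `0` of the induced map `t ↦ [φ t]` to `ℙV` is injective; at a smooth point `z`, where `X` is
an `n`-dimensional complex manifold, this means that the induced map of germs
`(ℂⁿ, 0) → (X, z)` is biholomorphic. -/
structure IsLocalParametrization (X : Set (PP V)) (z : PP V) {n : ℕ}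
    (φ : (Fin n → ℂ) → Module.Dual ℂ V) : Prop where
  dim_eq : topologicalKrullDim X = (n : WithBot ℕ∞)
  holomorphic : ∀ v : V, AnalyticAt ℂ (fun t => φ t v) 0
  mem_cone : ∀ᶠ t in 𝓝 0, φ t ∈ affineCone X
  base_point : ∃ h : φ 0 ≠ 0, Projectivization.mk ℂ (φ 0) h = z
  immersive : ∀ (u : Fin n → ℂ) (c : ℂ),
    (∀ v : V, fderiv ℂ (fun t => φ t v) 0 u = c * φ 0 v) → u = 0

/-- The linear span in `V*` of the partial derivatives `∂_{i_1} ⋯ ∂_{i_m} φ (0)` of all orders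
`m ≤ k`. If `φ` lifts a local parametrization of `X` at `z`, this is the affine cone over the
projective `k`-osculating space to `X` at `z`. -/
def osculatingCone {n : ℕ} (k : ℕ) (φ : (Fin n → ℂ) → Module.Dual ℂ V) :
    Submodule ℂ (Module.Dual ℂ V) :=
  Submodule.span ℂ {w | ∃ m ≤ k, ∃ i : Fin m → Fin n, ∀ v : V,
    w v = iteratedFDeriv ℂ m (fun t => φ t v) 0 (fun j => Pi.single (i j) 1)}

/-- `φ` consists of liftings of local parametrizations of `X` at `q` smooth points. -/
def IsSmoothTuple (X : Set (PP V)) {q n : ℕ}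
    (φ : Fin q → (Fin n → ℂ) → Module.Dual ℂ V) : Prop :=
  ∀ j, ∃ z ∈ smoothLocus X, IsLocalParametrization X z (φ j)

/-- The affine cone over the linear span of the `k`-osculating spaces at `q` points, given by
liftings of local parametrizations at these points. -/
def osculatingSpan {q n : ℕ} (k : ℕ) (φ : Fin q → (Fin n → ℂ) → Module.Dual ℂ V) :
    Submodule ℂ (Module.Dual ℂ V) :=
  ⨆ j, osculatingCone k (φ j)

/-- The `q`-secant variety `σ_q τ^k X` to the `k`-osculating variety to `X`: the Zariski closure of
the union of the linear spans of the `k`-osculating spaces at `q` smooth points, over all those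
`q`-tuples of smooth points for which the span has the maximal dimension. -/
def secantOsculating (X : Set (PP V)) (q k : ℕ) : Set (PP V) :=
  closure {p | ∃ (n : ℕ) (φ : Fin q → (Fin n → ℂ) → Module.Dual ℂ V),
    IsSmoothTuple X φ ∧
    (∀ ψ : Fin q → (Fin n → ℂ) → Module.Dual ℂ V, IsSmoothTuple X ψ →
      Module.finrank ℂ (osculatingSpan k ψ) ≤ Module.finrank ℂ (osculatingSpan k φ)) ∧
    p.rep ∈ osculatingSpan k φ}

end Projective

/-! ### Tensors of linear forms -/

section Tensors

open PiTensorProduct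

variable {V : Type*} [AddCommGroup V] [Module ℂ V]
variable {ℓ : ℕ} {W : Fin ℓ → Type*} [∀ i, AddCommGroup (W i)] [∀ i, Module ℂ (W i)]

/-- `T` is 1-generic: it does not vanish on tensor products of nonzero vectors. -/
def IsOneGeneric (T : (⨂[ℂ] i, W i) →ₗ[ℂ] V) : Prop :=
  ∀ w : ∀ i, W i, (∀ i, w i ≠ 0) → T (tprod ℂ w) ≠ 0

/-- A linear functional on `W_1 ⊗ ⋯ ⊗ W_ℓ`, viewed as an element of `W_1* ⊗ ⋯ ⊗ W_ℓ*`, is simple: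
it is equal to `f_1 ⊗ ⋯ ⊗ f_ℓ` for some nonzero `f_i ∈ W_i*`. -/
def IsSimpleTensor (g : Module.Dual ℂ (⨂[ℂ] i, W i)) : Prop :=
  ∃ f : ∀ i, Module.Dual ℂ (W i), (∀ i, f i ≠ 0) ∧ g = dualDistrib (tprod ℂ f)

/-- `T` is `X`-simple: at a general point `x` of the affine cone over `X`, the tensor `T* x` is
simple or zero. Here "general" means: over some nonempty Zariski open subset of `X`. -/
def IsSimpleOn (X : Set (PP V)) (T : (⨂[ℂ] i, W i) →ₗ[ℂ] V) : Prop :=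
  ∃ U : Set (PP V), IsOpen U ∧ (U ∩ X).Nonempty ∧
    ∀ (x : Module.Dual ℂ V) (hx : x ≠ 0), Projectivization.mk ℂ x hx ∈ U ∩ X →
      IsSimpleTensor (x ∘ₗ T) ∨ x ∘ₗ T = 0

/-- `T` is `X`-multiplicative: it is 1-generic and `X`-simple. -/
def IsMultiplicative (X : Set (PP V)) (T : (⨂[ℂ] i, W i) →ₗ[ℂ] V) : Prop :=
  IsOneGeneric T ∧ IsSimpleOn X T

/-! ### The map `b_n(T)` -/

/-- The right action of `ℂ` on a complex vector space, needed only to form the commutative algebra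
`ℂ ⊕ M` with `M² = 0`. -/
abbrev opModule (M : Type*) [AddCommGroup M] [Module ℂ M] : Module ℂᵐᵒᵖ M :=
  Module.compHom M ((RingHom.id ℂ).fromOpposite mul_comm)

attribute [local instance] opModule

lemma opModule_central (M : Type*) [AddCommGroup M] [Module ℂ M] : IsCentralScalar ℂ M :=
  ⟨fun _ _ => rfl⟩

attribute [local instance] opModule_central

variable (W) in
/-- The interchange of tensor factors `⨂_i ⨂_j W_i → ⨂_j ⨂_i W_i`, see `interchange_tprod`. It is
built as a product in the commutative algebra `⨂_j ⨂_i (ℂ ⊕ W_i)`, where `W_i² = 0`. -/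
def interchange (n : ℕ) :
    (⨂[ℂ] i, ⨂[ℂ] _j : Fin n, W i) →ₗ[ℂ] ⨂[ℂ] _j : Fin n, ⨂[ℂ] i, W i :=
  PiTensorProduct.map (fun _ => PiTensorProduct.map fun i => TrivSqZeroExt.sndHom ℂ (W i)) ∘ₗ
    PiTensorProduct.lift
      ((MultilinearMap.mkPiAlgebra ℂ (Fin ℓ)
          (⨂[ℂ] _j : Fin n, ⨂[ℂ] i, TrivSqZeroExt ℂ (W i))).compLinearMap
        fun i => PiTensorProduct.map fun _ =>
          (singleAlgHom (R := ℂ) (A := fun i => TrivSqZeroExt ℂ (W i)) i).toLinearMap ∘ₗ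
            TrivSqZeroExt.inrHom ℂ (W i))

lemma interchange_tprod (n : ℕ) (x : ∀ i, Fin n → W i) :
    interchange W n (⨂ₜ[ℂ] i, ⨂ₜ[ℂ] j, x i j) = ⨂ₜ[ℂ] j, ⨂ₜ[ℂ] i, x i j := by
  have h (j : Fin n) (i : Fin ℓ) :
      singleAlgHom (R := ℂ) (A := fun i => TrivSqZeroExt ℂ (W i)) i
          (TrivSqZeroExt.inr (x i j)) =
        PiTensorProduct.tprod ℂ (Pi.mulSingle i (TrivSqZeroExt.inr (x i j) : TrivSqZeroExt ℂ (W i))) := rfl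
  have h' (j : Fin n) :
      (∏ i, PiTensorProduct.tprod ℂ (Pi.mulSingle i (TrivSqZeroExt.inr (x i j) : TrivSqZeroExt ℂ (W i)))) =
        tprod ℂ fun i => (TrivSqZeroExt.inr (x i j) : TrivSqZeroExt ℂ (W i)) := by
    rw [← tprod_prod, Finset.univ_prod_mulSingle]
  simp only [interchange, LinearMap.comp_apply, lift.tprod, MultilinearMap.compLinearMap_apply,
    map_tprod, MultilinearMap.mkPiAlgebra_apply, AlgHom.toLinearMap_apply,
    TrivSqZeroExt.inrHom_apply, h]
  rw [← tprod_prod, map_tprod]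
  congr 1
  funext j
  rw [Finset.prod_apply, h', map_tprod]
  simp

/-- The canonical map `⋀ⁿW_1 ⊗ ⋯ ⊗ ⋀ⁿW_ℓ → Sⁿ(W_1 ⊗ ⋯ ⊗ W_ℓ)`, see `canonicalMap_tprod`; for
`ℓ = 2` it is the determinant map. -/
def canonicalMap (W : Fin ℓ → Type*) [∀ i, AddCommGroup (W i)] [∀ i, Module ℂ (W i)] (n : ℕ) :
    (⨂[ℂ] i, ⋀[ℂ]^n (W i)) →ₗ[ℂ] SymmetricAlgebra ℂ (⨂[ℂ] i, W i) :=
  (n.factorial : ℂ)⁻¹ •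
    (PiTensorProduct.lift ((MultilinearMap.mkPiAlgebra ℂ (Fin n)
        (SymmetricAlgebra ℂ (⨂[ℂ] i, W i))).compLinearMap fun _ => SymmetricAlgebra.ι ℂ _) ∘ₗ
      interchange W n ∘ₗ
      PiTensorProduct.map fun i => exteriorPower.toTensorPower ℂ (W i) n)

lemma canonicalMap_tprod (n : ℕ) (x : ∀ i, Fin n → W i) :
    canonicalMap W n (⨂ₜ[ℂ] i, exteriorPower.ιMulti ℂ n (x i)) =
      (n.factorial : ℂ)⁻¹ • ∑ σ : Fin ℓ → Equiv.Perm (Fin n),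
        (∏ i, ((Equiv.Perm.sign (σ i) : ℤ) : ℂ)) •
          ∏ j, SymmetricAlgebra.ι ℂ _ (⨂ₜ[ℂ] i, x i (σ i j)) := by
  simp only [canonicalMap, LinearMap.smul_apply, LinearMap.comp_apply, map_tprod,
    exteriorPower.toTensorPower_apply_ιMulti, MultilinearMap.map_sum, map_sum]
  congr 1
  refine Finset.sum_congr rfl fun σ _ => ?_
  have h : (tprod ℂ fun i => Equiv.Perm.sign (σ i) •
      ⨂ₜ[ℂ] j : Fin n, x i (σ i j)) =
      (∏ i, ((Equiv.Perm.sign (σ i) : ℤ) : ℂ)) •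
        ⨂ₜ[ℂ] i, ⨂ₜ[ℂ] j : Fin n, x i (σ i j) := by
    rw [← MultilinearMap.map_smul_univ]
    exact congrArg _ (funext fun i => by rw [Units.smul_def, Int.cast_smul_eq_zsmul])
  rw [h, map_smul, map_smul, interchange_tprod, lift.tprod]
  simp

/-- The map `b_n(T) : ⋀ⁿW_1 ⊗ ⋯ ⊗ ⋀ⁿW_ℓ → SⁿV`: the canonical map to `Sⁿ(W_1 ⊗ ⋯ ⊗ W_ℓ)` followed
by the map of symmetric powers induced by `T`. -/
def bMap (n : ℕ) (T : (⨂[ℂ] i, W i) →ₗ[ℂ] V) :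
    (⨂[ℂ] i, ⋀[ℂ]^n (W i)) →ₗ[ℂ] SymmetricAlgebra ℂ V :=
  (SymmetricAlgebra.lift (SymmetricAlgebra.ι ℂ V ∘ₗ T)).toLinearMap ∘ₗ canonicalMap W n

end Tensors

end SecOsc

end

/-! Evaluated at `x`, a generator of the image of `b_{q+1}(T)` is, up to the factor `1/(q+1)!`, the
diagonal value of the multilinear form `hyperdet`, an alternating sum over tuples of permutations.

Vanishing: if `x` is a sum of `q` vectors, one in each osculating cone, multilinear expansion over
`q + 1` slots puts two arguments in the same cone. Such a term is a mixed derivative at `s = t = 0`,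
of order at most `k` in each variable, of the form with `φ(s)` and `φ(t)` in those slots. Where
`T*φ` is nonzero it has rank one, and antisymmetrizing the two slots in each tensor factor gives a
combination of products of `2k + 2` two-by-two minors (`two_pow_mul_sum_coeff`). Each minor vanishes
for `s = t`, so derivatives of total order at most `2k` are zero
(`sum_coeff_iteratedFDeriv_eq_zero`). Rank at most one is encoded by the polynomial identity
`SatisfiesExchange`, which irreducibility carries from general points to the whole cone.

Nonvanishing: 1-genericity and nondegeneracy give points `x_j` of the cone and vectors making all
the evaluation matrices triangular (`exists_triangular`). At `∑ x_j` every bijective assignment of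
points to slots contributes the same nonzero product of determinants, the signs cancelling because
the number of factors is even. -/

namespace SecOsc

/-! ### Iterated directional derivatives and order of vanishing -/

section Calculus

variable {E F : Type*} [NormedAddCommGroup E] [NormedSpace ℂ E]
  [NormedAddCommGroup F] [NormedSpace ℂ F]

/-- The iterated directional derivative of `f` along the vectors of a list, the last vector of the
list being used first. -/
noncomputable def iterDir (L : List E) (f : E → ℂ) : E → ℂ :=
  L.foldr (fun v g y => fderiv ℂ g y v) f

@[simp] lemma iterDir_nil (f : E → ℂ) : iterDir [] f = f := rfl

@[simp] lemma iterDir_cons (v : E) (L : List E) (f : E → ℂ) :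
    iterDir (v :: L) f = fun y => fderiv ℂ (iterDir L f) y v := rfl

lemma iterDir_append (L L' : List E) (f : E → ℂ) :
    iterDir (L ++ L') f = iterDir L (iterDir L' f) := by
  simp [iterDir, List.foldr_append]

lemma analyticAt_fderiv_apply {f : E → ℂ} {x : E} (hf : AnalyticAt ℂ f x) (v : E) :
    AnalyticAt ℂ (fun y => fderiv ℂ f y v) x :=
  ((ContinuousLinearMap.apply ℂ ℂ v).analyticAt _).comp hf.fderiv

lemma analyticAt_iterDir {f : E → ℂ} {x : E} (hf : AnalyticAt ℂ f x) (L : List E) :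
    AnalyticAt ℂ (iterDir L f) x := by
  induction L with
  | nil => exact hf
  | cons v L ih => exact analyticAt_fderiv_apply ih v

lemma fderiv_apply_congr {f g : E → ℂ} {x : E} (h : f =ᶠ[𝓝 x] g) (v : E) :
    (fun y => fderiv ℂ f y v) =ᶠ[𝓝 x] fun y => fderiv ℂ g y v := by
  filter_upwards [h.fderiv (𝕜 := ℂ)] with y hy
  rw [hy]

lemma iterDir_congr {f g : E → ℂ} {x : E} (h : f =ᶠ[𝓝 x] g) (L : List E) :
    iterDir L f =ᶠ[𝓝 x] iterDir L g := by
  induction L with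
  | nil => exact h
  | cons v L ih => exact fderiv_apply_congr ih v

lemma iterDir_sum {ι : Type*} (s : Finset ι) (c : ι → ℂ) {f : ι → E → ℂ} {x : E}
    (hf : ∀ i, AnalyticAt ℂ (f i) x) (L : List E) :
    iterDir L (fun y => ∑ i ∈ s, c i * f i y) =ᶠ[𝓝 x] fun y => ∑ i ∈ s, c i * iterDir L (f i) y := by
  induction L with
  | nil => rfl
  | cons v L ih =>
    refine (fderiv_apply_congr ih v).trans ?_
    have h : ∀ᶠ y in 𝓝 x, ∀ i ∈ s, AnalyticAt ℂ (iterDir L (f i)) y :=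
      (Filter.eventually_all_finset s).2 fun i _ => (analyticAt_iterDir (hf i) L).eventually_analyticAt
    filter_upwards [h] with y hy
    rw [fderiv_fun_sum fun i hi => (hy i hi).differentiableAt.const_mul (c i)]
    simp only [sum_apply, iterDir_cons]
    refine Finset.sum_congr rfl fun i hi => ?_
    rw [fderiv_const_mul (hy i hi).differentiableAt]
    simp

/-- Equality near `x`, not just at `x`, is what allows the induction to differentiate once more. -/
lemma iteratedFDeriv_eq_iterDir {f : E → ℂ} {x : E} (hf : AnalyticAt ℂ f x) (m : ℕ)
    (e : Fin m → E) :
    (fun y => iteratedFDeriv ℂ m f y e) =ᶠ[𝓝 x] iterDir (List.ofFn e) f := by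
  induction m with
  | zero => exact Filter.Eventually.of_forall fun y => by simp
  | succ m ih =>
    rw [List.ofFn_succ, iterDir_cons]
    refine Filter.EventuallyEq.trans ?_ (fderiv_apply_congr (ih fun i => e i.succ) (e 0))
    filter_upwards [hf.eventually_analyticAt] with y hy
    have hd : DifferentiableAt ℂ (iteratedFDeriv ℂ m f) y :=
      hy.contDiffAt.differentiableAt_iteratedFDeriv (n := (m + 1 : ℕ))
        (by exact_mod_cast Nat.lt_succ_self m)
    exact hd.iteratedFDeriv_succ_apply_left'

lemma iterDir_prod {f : E → ℂ} {g : F → ℂ} {x : E} {y : F} (hf : AnalyticAt ℂ f x)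
    (hg : AnalyticAt ℂ g y) (L : List E) (L' : List F) :
    iterDir (L.map (fun v => ((v, 0) : E × F)) ++ L'.map fun v => (0, v))
        (fun p => f p.1 * g p.2) =ᶠ[𝓝 (x, y)]
      fun p => iterDir L f p.1 * iterDir L' g p.2 := by
  have hdf (L : List E) : ∀ᶠ p : E × F in 𝓝 (x, y), DifferentiableAt ℂ (iterDir L f) p.1 :=
    continuousAt_fst.eventually
      ((analyticAt_iterDir hf L).eventually_analyticAt.mono fun _ h => h.differentiableAt)
  have hdg (L : List F) : ∀ᶠ p : E × F in 𝓝 (x, y), DifferentiableAt ℂ (iterDir L g) p.2 :=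
    continuousAt_snd.eventually
      ((analyticAt_iterDir hg L).eventually_analyticAt.mono fun _ h => h.differentiableAt)
  have key (L : List E) (L' : List F) (v : E × F) : ∀ᶠ p : E × F in 𝓝 (x, y),
      fderiv ℂ (fun p : E × F => iterDir L f p.1 * iterDir L' g p.2) p v =
        iterDir L f p.1 * fderiv ℂ (iterDir L' g) p.2 v.2 +
          iterDir L' g p.2 * fderiv ℂ (iterDir L f) p.1 v.1 := by
    filter_upwards [hdf L, hdg L'] with p h1 h2
    have h1' : HasFDerivAt (fun p : E × F => iterDir L f p.1) _ p :=
      h1.hasFDerivAt.comp p hasFDerivAt_fst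
    have h2' : HasFDerivAt (fun p : E × F => iterDir L' g p.2) _ p :=
      h2.hasFDerivAt.comp p hasFDerivAt_snd
    rw [(h1'.fun_mul h2').fderiv]
    simp
  have h0 : iterDir (L'.map fun v => ((0, v) : E × F)) (fun p => f p.1 * g p.2) =ᶠ[𝓝 (x, y)]
      fun p => f p.1 * iterDir L' g p.2 := by
    induction L' with
    | nil => rfl
    | cons v L' ih =>
      refine (fderiv_apply_congr ih (0, v)).trans ?_
      filter_upwards [key [] L' (0, v)] with p hp
      simpa using hp
  rw [iterDir_append]
  refine (iterDir_congr h0 _).trans ?_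
  induction L with
  | nil => rfl
  | cons v L ih =>
    refine (fderiv_apply_congr ih (v, 0)).trans ?_
    filter_upwards [key L L' (v, 0)] with p hp
    rw [hp]
    simp [mul_comm]

/-- The function `f` is analytic at `x` and vanishes there to order at least `m`. -/
def VanishesToOrder (x : E) : ℕ → (E → ℂ) → Prop
  | 0, f => AnalyticAt ℂ f x
  | m + 1, f => AnalyticAt ℂ f x ∧ f x = 0 ∧ ∀ v, VanishesToOrder x m fun y => fderiv ℂ f y v

namespace VanishesToOrder

lemma analyticAt {x : E} {m : ℕ} {f : E → ℂ} (h : VanishesToOrder x m f) : AnalyticAt ℂ f x := by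
  cases m with
  | zero => exact h
  | succ m => exact h.1

lemma congr {x : E} {m : ℕ} {f g : E → ℂ} (h : VanishesToOrder x m f) (hfg : f =ᶠ[𝓝 x] g) :
    VanishesToOrder x m g := by
  induction m generalizing f g with
  | zero => exact AnalyticAt.congr h hfg
  | succ m ih =>
    exact ⟨h.1.congr hfg, hfg.eq_of_nhds ▸ h.2.1, fun v => ih (h.2.2 v) (fderiv_apply_congr hfg v)⟩

lemma of_succ {x : E} {m : ℕ} {f : E → ℂ} (h : VanishesToOrder x (m + 1) f) :
    VanishesToOrder x m f := by
  induction m generalizing f with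
  | zero => exact h.1
  | succ m ih => exact ⟨h.1, h.2.1, fun v => ih (h.2.2 v)⟩

lemma mono {x : E} {m n : ℕ} {f : E → ℂ} (h : VanishesToOrder x n f) (hmn : m ≤ n) :
    VanishesToOrder x m f := by
  induction n, hmn using Nat.le_induction with
  | base => exact h
  | succ n _ ih => exact ih h.of_succ

lemma add {x : E} {m : ℕ} {f g : E → ℂ} (hf : VanishesToOrder x m f)
    (hg : VanishesToOrder x m g) : VanishesToOrder x m fun y => f y + g y := by
  induction m generalizing f g with
  | zero => exact AnalyticAt.fun_add hf hg
  | succ m ih =>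
    refine ⟨hf.1.fun_add hg.1, by simp [hf.2.1, hg.2.1], fun v => ?_⟩
    refine (ih (hf.2.2 v) (hg.2.2 v)).congr ?_
    filter_upwards [hf.1.eventually_analyticAt, hg.1.eventually_analyticAt] with y h1 h2
    rw [fderiv_fun_add h1.differentiableAt h2.differentiableAt]
    rfl

lemma zero (x : E) (m : ℕ) : VanishesToOrder x m fun _ => 0 := by
  induction m with
  | zero => exact analyticAt_const
  | succ m ih => exact ⟨analyticAt_const, rfl, fun v => by simpa using ih⟩

lemma sum {ι : Type*} {x : E} {m : ℕ} (s : Finset ι) {f : ι → E → ℂ}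
    (hf : ∀ i ∈ s, VanishesToOrder x m (f i)) : VanishesToOrder x m fun y => ∑ i ∈ s, f i y := by
  classical
  induction s using Finset.induction_on with
  | empty => simpa using zero x m
  | insert i s hi ih =>
    simp only [Finset.sum_insert hi]
    exact (hf i (by simp)).add (ih fun j hj => hf j (by simp [hj]))

lemma mul {x : E} {m n : ℕ} {f g : E → ℂ} (hf : VanishesToOrder x m f)
    (hg : VanishesToOrder x n g) : VanishesToOrder x (m + n) fun y => f y * g y := by
  obtain ⟨N, hN⟩ : ∃ N, N = m + n := ⟨_, rfl⟩
  rw [← hN]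
  induction N generalizing m n f g with
  | zero => exact hf.analyticAt.fun_mul hg.analyticAt
  | succ N ih =>
    refine ⟨hf.analyticAt.fun_mul hg.analyticAt, ?_, fun v => ?_⟩
    · cases m with
      | zero =>
        cases n with
        | zero => omega
        | succ n => simp [hg.2.1]
      | succ m => simp [hf.2.1]
    · have h1 : VanishesToOrder x N fun y => f y * fderiv ℂ g y v := by
        cases n with
        | zero =>
          -- Differentiating `g` costs no order when `n = 0`; the surplus order is given up on `f`
          -- so that the total is `N`.
          exact (ih (m := m - 1) (n := 0) (hf.mono (by omega))
            (analyticAt_fderiv_apply hg v) (by omega))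
        | succ n => exact ih hf (hg.2.2 v) (by omega)
      have h2 : VanishesToOrder x N fun y => fderiv ℂ f y v * g y := by
        cases m with
        | zero =>
          exact (ih (m := 0) (n := n - 1) (analyticAt_fderiv_apply hf v)
            (hg.mono (by omega)) (by omega))
        | succ m => exact ih (hf.2.2 v) hg (by omega)
      refine (h1.add h2).congr ?_
      filter_upwards [hf.analyticAt.eventually_analyticAt, hg.analyticAt.eventually_analyticAt]
        with y a b
      rw [fderiv_fun_mul a.differentiableAt b.differentiableAt]
      simp [mul_comm]

lemma prod {ι : Type*} {x : E} (s : Finset ι) {f : ι → E → ℂ}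
    (hf : ∀ i ∈ s, VanishesToOrder x 1 (f i)) :
    VanishesToOrder x s.card fun y => ∏ i ∈ s, f i y := by
  classical
  induction s using Finset.induction_on with
  | empty => exact analyticAt_const
  | insert i s hi ih =>
    simp only [Finset.prod_insert hi, Finset.card_insert_of_notMem hi]
    rw [add_comm]
    exact (hf i (by simp)).mul (ih fun j hj => hf j (by simp [hj]))

lemma of_eq_zero {x : E} {f : E → ℂ} (hf : AnalyticAt ℂ f x) (h : f x = 0) :
    VanishesToOrder x 1 f :=
  ⟨hf, h, fun v => analyticAt_fderiv_apply hf v⟩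

lemma iterDir {x : E} {m : ℕ} {f : E → ℂ} (L : List E) (hf : VanishesToOrder x (m + L.length) f) :
    VanishesToOrder x m (SecOsc.iterDir L f) := by
  induction L generalizing m with
  | nil => exact hf
  | cons v L ih =>
    have h := ih (m := m + 1) (hf.mono (by simp; omega))
    exact h.2.2 v

lemma iterDir_eq_zero {x : E} {m : ℕ} {f : E → ℂ} (hf : VanishesToOrder x m f) (L : List E)
    (hL : L.length < m) : SecOsc.iterDir L f x = 0 :=
  (iterDir (m := 1) L (hf.mono (by omega))).2.1

end VanishesToOrder

/-- If `∑ c_i f_i(s) g_i(t)` vanishes at `(x, x)` to an order exceeding `m + n`, then so do the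
partial derivatives of orders `m` in `s` and `n` in `t`. -/
lemma sum_iteratedFDeriv_mul_eq_zero {ι : Type*} [Fintype ι] (c : ι → ℂ) {f g : ι → E → ℂ} {x : E}
    (hf : ∀ i, AnalyticAt ℂ (f i) x) (hg : ∀ i, AnalyticAt ℂ (g i) x) {N m n : ℕ}
    (h : VanishesToOrder (x, x) N fun p : E × E => ∑ i, c i * (f i p.1 * g i p.2))
    (hN : m + n < N) (d : Fin m → E) (e : Fin n → E) :
    ∑ i, c i * (iteratedFDeriv ℂ m (f i) x d * iteratedFDeriv ℂ n (g i) x e) = 0 := by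
  have h1 := h.iterDir_eq_zero ((List.ofFn d).map (fun v => ((v, 0) : E × E)) ++
    (List.ofFn e).map fun v => (0, v)) (by simpa using hN)
  rw [(iterDir_sum Finset.univ c (f := fun i (p : E × E) => f i p.1 * g i p.2) (fun i =>
    ((hf i).comp_of_eq analyticAt_fst rfl).fun_mul ((hg i).comp_of_eq analyticAt_snd rfl))
    _).eq_of_nhds] at h1
  rw [← h1]
  refine Finset.sum_congr rfl fun i _ => ?_
  rw [(iterDir_prod (hf i) (hg i) _ _).eq_of_nhds, (iteratedFDeriv_eq_iterDir (hf i) m d).eq_of_nhds,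
    (iteratedFDeriv_eq_iterDir (hg i) n e).eq_of_nhds]

lemma continuousAt_iteratedFDeriv_apply {f : E → ℂ} {x : E} (hf : AnalyticAt ℂ f x) (m : ℕ)
    (e : Fin m → E) : ContinuousAt (fun y => iteratedFDeriv ℂ m f y e) x :=
  (analyticAt_iterDir hf _).continuousAt.congr (iteratedFDeriv_eq_iterDir hf m e).symm

end Calculus

/-! ### The hyperdeterminant -/

section Hyperdeterminant

open PiTensorProduct

variable {V : Type*} [AddCommGroup V] [Module ℂ V]
variable {ℓ n : ℕ} {W : Fin ℓ → Type*} [∀ i, AddCommGroup (W i)] [∀ i, Module ℂ (W i)]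

/-- The polarization of the form `n! · b_n(T)(⨂_i v_{i,0} ∧ ⋯ ∧ v_{i,n-1})`. -/
noncomputable def hyperdet (T : (⨂[ℂ] i, W i) →ₗ[ℂ] V) (v : ∀ i, Fin n → W i) :
    MultilinearMap ℂ (fun _ : Fin n => Module.Dual ℂ V) ℂ :=
  ∑ σ : Fin ℓ → Equiv.Perm (Fin n), (∏ i, ((Equiv.Perm.sign (σ i) : ℤ) : ℂ)) •
    (MultilinearMap.mkPiAlgebra ℂ (Fin n) ℂ).compLinearMap
      fun j => Module.Dual.eval ℂ V (T (⨂ₜ[ℂ] i, v i (σ i j)))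

lemma hyperdet_apply (T : (⨂[ℂ] i, W i) →ₗ[ℂ] V) (v : ∀ i, Fin n → W i)
    (y : Fin n → Module.Dual ℂ V) :
    hyperdet T v y = ∑ σ : Fin ℓ → Equiv.Perm (Fin n),
      (∏ i, ((Equiv.Perm.sign (σ i) : ℤ) : ℂ)) * ∏ j, y j (T (⨂ₜ[ℂ] i, v i (σ i j))) := by
  simp [hyperdet]

lemma evalAt_bMap_tprod (T : (⨂[ℂ] i, W i) →ₗ[ℂ] V) (v : ∀ i, Fin n → W i)
    (x : Module.Dual ℂ V) :
    evalAt x (bMap n T (⨂ₜ[ℂ] i, exteriorPower.ιMulti ℂ n (v i))) =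
      (n.factorial : ℂ)⁻¹ * hyperdet T v fun _ => x := by
  simp only [bMap, LinearMap.comp_apply, canonicalMap_tprod, AlgHom.toLinearMap_apply, map_smul,
    map_sum, map_prod, SymmetricAlgebra.lift_ι_apply, evalAt, hyperdet_apply, smul_eq_mul]

/-- On functionals that are simple along `T`, the hyperdeterminant is a product of determinants. -/
lemma hyperdet_of_simple (T : (⨂[ℂ] i, W i) →ₗ[ℂ] V) (v : ∀ i, Fin n → W i)
    (y : Fin n → Module.Dual ℂ V) (u : Fin n → ℂ) (f : Fin n → ∀ i, W i → ℂ)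
    (h : ∀ (j : Fin n) (w : ∀ i, W i), y j (T (⨂ₜ[ℂ] i, w i)) = u j * ∏ i, f j i (w i)) :
    hyperdet T v y = (∏ j, u j) * ∏ i, (Matrix.of fun p j => f j i (v i p)).det := by
  simp only [hyperdet_apply, h, Matrix.det_apply', Matrix.of_apply, Finset.prod_mul_distrib]
  rw [Finset.prod_univ_sum, Finset.mul_sum, Fintype.piFinset_univ]
  refine Finset.sum_congr rfl fun σ _ => ?_
  rw [Finset.prod_mul_distrib, Finset.prod_comm]
  ring

/-- The coefficient of `y_a(⬝) y_b(⬝)` in the term of the hyperdeterminant given by `σ`. -/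
noncomputable def hyperdetCoeff (T : (⨂[ℂ] i, W i) →ₗ[ℂ] V) (v : ∀ i, Fin n → W i)
    (y : Fin n → Module.Dual ℂ V) (a b : Fin n) (σ : Fin ℓ → Equiv.Perm (Fin n)) : ℂ :=
  (∏ i, ((Equiv.Perm.sign (σ i) : ℤ) : ℂ)) *
    ∏ j ∈ (Finset.univ.erase a).erase b, y j (T (⨂ₜ[ℂ] i, v i (σ i j)))

lemma hyperdet_eq_sum_coeff (T : (⨂[ℂ] i, W i) →ₗ[ℂ] V) (v : ∀ i, Fin n → W i)
    (y : Fin n → Module.Dual ℂ V) {a b : Fin n} (hab : a ≠ b) :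
    hyperdet T v y = ∑ σ : Fin ℓ → Equiv.Perm (Fin n), hyperdetCoeff T v y a b σ *
      (y a (T (⨂ₜ[ℂ] i, v i (σ i a))) * y b (T (⨂ₜ[ℂ] i, v i (σ i b)))) := by
  rw [hyperdet_apply]
  refine Finset.sum_congr rfl fun σ _ => ?_
  rw [hyperdetCoeff, ← Finset.mul_prod_erase Finset.univ _ (Finset.mem_univ a),
    ← Finset.mul_prod_erase (Finset.univ.erase a) _ (a := b) (by simp [hab.symm])]
  ring

/-- The coefficient involves only the slots other than `a` and `b`, which `π` fixes, so only the
signs change. -/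
lemma hyperdetCoeff_mul (T : (⨂[ℂ] i, W i) →ₗ[ℂ] V) (v : ∀ i, Fin n → W i)
    (y : Fin n → Module.Dual ℂ V) (a b : Fin n) (σ π : Fin ℓ → Equiv.Perm (Fin n))
    (hπ : ∀ i j, j ≠ a → j ≠ b → π i j = j) :
    hyperdetCoeff T v y a b (σ * π) =
      (∏ i, ((Equiv.Perm.sign (π i) : ℤ) : ℂ)) * hyperdetCoeff T v y a b σ := by
  have h : ∏ j ∈ (Finset.univ.erase a).erase b, y j (T (⨂ₜ[ℂ] i, v i ((σ * π) i j))) =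
      ∏ j ∈ (Finset.univ.erase a).erase b, y j (T (⨂ₜ[ℂ] i, v i (σ i j))) := by
    refine Finset.prod_congr rfl fun j hj => ?_
    simp only [Finset.mem_erase] at hj
    simp only [Pi.mul_apply, Equiv.Perm.mul_apply, hπ _ j hj.2.1 hj.1]
  simp only [hyperdetCoeff, h]
  simp only [Pi.mul_apply, Equiv.Perm.sign_mul, Units.val_mul, Int.cast_mul,
    Finset.prod_mul_distrib]
  ring

/-- Antisymmetrization in two places of each factor. -/
lemma two_pow_mul_sum_coeff (T : (⨂[ℂ] i, W i) →ₗ[ℂ] V) (v : ∀ i, Fin n → W i)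
    (y : Fin n → Module.Dual ℂ V) {a b : Fin n} (hab : a ≠ b) (f g : ∀ i, W i → ℂ) :
    2 ^ ℓ * ∑ σ : Fin ℓ → Equiv.Perm (Fin n), hyperdetCoeff T v y a b σ *
        ((∏ i, f i (v i (σ i a))) * ∏ i, g i (v i (σ i b))) =
      ∑ σ : Fin ℓ → Equiv.Perm (Fin n), hyperdetCoeff T v y a b σ *
        ∏ i, (f i (v i (σ i a)) * g i (v i (σ i b)) - f i (v i (σ i b)) * g i (v i (σ i a))) := by
  -- A choice `ε` of the factors in which `a` and `b` are swapped. Averaging over all `2 ^ ℓ`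
  -- choices turns each factor into a two-by-two minor.
  set π : (Fin ℓ → Bool) → Fin ℓ → Equiv.Perm (Fin n) :=
    fun ε i => if ε i then Equiv.swap a b else 1 with hπ
  set S := fun σ : Fin ℓ → Equiv.Perm (Fin n) => hyperdetCoeff T v y a b σ *
    ((∏ i, f i (v i (σ i a))) * ∏ i, g i (v i (σ i b))) with hS
  have h1 (ε : Fin ℓ → Bool) : ∑ σ, S σ = ∑ σ, S (σ * π ε) :=
    (Fintype.sum_equiv (Equiv.mulRight (π ε)) _ _ fun σ => rfl).symm
  have h2 (ε : Fin ℓ → Bool) (σ : Fin ℓ → Equiv.Perm (Fin n)) : S (σ * π ε) =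
      hyperdetCoeff T v y a b σ * ∏ i, (if ε i then -(f i (v i (σ i b)) * g i (v i (σ i a)))
        else f i (v i (σ i a)) * g i (v i (σ i b))) := by
    simp only [hS]
    rw [hyperdetCoeff_mul, mul_comm (∏ i, _) (hyperdetCoeff _ _ _ _ _ _), mul_assoc,
      ← Finset.prod_mul_distrib, ← Finset.prod_mul_distrib]
    · congr 1
      refine Finset.prod_congr rfl fun i _ => ?_
      cases hε : ε i <;> simp [hπ, hε, Equiv.Perm.sign_swap hab]
    · intro i j hja hjb
      cases hε : ε i <;> simp [hπ, hε, Equiv.swap_apply_of_ne_of_ne hja hjb]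
  calc 2 ^ ℓ * ∑ σ, S σ = ∑ _ε : Fin ℓ → Bool, ∑ σ, S σ := by simp
    _ = ∑ ε : Fin ℓ → Bool, ∑ σ, S (σ * π ε) := Finset.sum_congr rfl fun ε _ => h1 ε
    _ = _ := by
      rw [Finset.sum_comm]
      refine Finset.sum_congr rfl fun σ _ => ?_
      simp only [h2]
      rw [← Finset.mul_sum]
      congr 1
      rw [← Fintype.piFinset_univ, ← Finset.prod_univ_sum (fun _ => Finset.univ)
        (fun i (e : Bool) => if e then -(f i (v i (σ i b)) * g i (v i (σ i a)))
        else f i (v i (σ i a)) * g i (v i (σ i b)))]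
      refine Finset.prod_congr rfl fun i _ => ?_
      simp
      ring

/-! ### The exchange identity -/

/-- The identity expressing that the tensor `T* x` has rank at most one. -/
def SatisfiesExchange (T : (⨂[ℂ] i, W i) →ₗ[ℂ] V) (x : Module.Dual ℂ V) : Prop :=
  ∀ v w : ∀ i, W i, x (T (⨂ₜ[ℂ] i, v i)) * x (T (⨂ₜ[ℂ] i, w i)) ^ (ℓ - 1) =
    ∏ i, x (T (⨂ₜ[ℂ] j, Function.update w i (v i) j))

lemma SatisfiesExchange.of_isSimpleTensor {T : (⨂[ℂ] i, W i) →ₗ[ℂ] V} {x : Module.Dual ℂ V}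
    (h : IsSimpleTensor (x ∘ₗ T)) : SatisfiesExchange T x := by
  obtain ⟨f, -, hf⟩ := h
  have hx (v : ∀ i, W i) : x (T (⨂ₜ[ℂ] i, v i)) = ∏ i, f i (v i) := by
    have := LinearMap.congr_fun hf (⨂ₜ[ℂ] i, v i)
    simpa using this
  intro v w
  simp only [hx]
  -- For fixed `j`, the index `i = j` contributes `f j (v j)` and each of the other `ℓ - 1` indices
  -- contributes `f j (w j)`.
  rw [Finset.prod_comm, ← Finset.prod_pow, ← Finset.prod_mul_distrib]
  refine Finset.prod_congr rfl fun j _ => ?_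
  rw [← Finset.mul_prod_erase Finset.univ _ (Finset.mem_univ j), Function.update_self]
  congr 1
  rw [Finset.prod_congr rfl fun i hi => by
    rw [Function.update_of_ne (Finset.ne_of_mem_erase hi).symm]]
  simp

/-- For `ℓ = 0` the right side of the identity is the empty product `1`, hence the assumption `ℓ ≠
0`. -/
lemma SatisfiesExchange.of_comp_eq_zero (hℓ : ℓ ≠ 0) {T : (⨂[ℂ] i, W i) →ₗ[ℂ] V}
    {x : Module.Dual ℂ V} (h : x ∘ₗ T = 0) : SatisfiesExchange T x := by
  have hx (t : ⨂[ℂ] i, W i) : x (T t) = 0 := LinearMap.congr_fun h t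
  intro v w
  have : Nonempty (Fin ℓ) := ⟨⟨0, by omega⟩⟩
  simp [hx, hℓ]

/-- The factors in `IsSimpleTensor` are chosen pointwise, with no regularity in `x`. Those found
here are evaluations of `x` at fixed vectors, so they vary holomorphically along a parametrization.
-/
lemma SatisfiesExchange.eq_mul_prod {T : (⨂[ℂ] i, W i) →ₗ[ℂ] V} {x : Module.Dual ℂ V}
    (h : SatisfiesExchange T x) {w : ∀ i, W i} (hw : x (T (⨂ₜ[ℂ] i, w i)) ≠ 0) (v : ∀ i, W i) :
    x (T (⨂ₜ[ℂ] i, v i)) = (x (T (⨂ₜ[ℂ] i, w i)) ^ (ℓ - 1))⁻¹ *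
      ∏ i, x (T (⨂ₜ[ℂ] j, Function.update w i (v i) j)) := by
  rw [← h v w]
  field_simp

/-! ### Vanishing on osculating spaces -/

lemma sum_coeff_iteratedFDeriv_eq_zero {E : Type*} [NormedAddCommGroup E] [NormedSpace ℂ E]
    (T : (⨂[ℂ] i, W i) →ₗ[ℂ] V) (v : ∀ i, Fin n → W i)
    (y : Fin n → Module.Dual ℂ V) {a b : Fin n} (hab : a ≠ b) {φ : E → Module.Dual ℂ V} {x : E}
    (hφ : ∀ p : V, AnalyticAt ℂ (fun t => φ t p) x)
    (hex : ∀ᶠ t in 𝓝 x, SatisfiesExchange T (φ t)) {w : ∀ i, W i}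
    (hw : φ x (T (⨂ₜ[ℂ] i, w i)) ≠ 0) {m m' : ℕ} (hm : m + m' < ℓ) (d : Fin m → E)
    (d' : Fin m' → E) :
    ∑ σ : Fin ℓ → Equiv.Perm (Fin n), hyperdetCoeff T v y a b σ *
      (iteratedFDeriv ℂ m (fun t => φ t (T (⨂ₜ[ℂ] i, v i (σ i a)))) x d *
        iteratedFDeriv ℂ m' (fun t => φ t (T (⨂ₜ[ℂ] i, v i (σ i b)))) x d') = 0 := by
  refine sum_iteratedFDeriv_mul_eq_zero (fun σ => hyperdetCoeff T v y a b σ)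
    (f := fun σ t => φ t (T (⨂ₜ[ℂ] i, v i (σ i a))))
    (g := fun σ t => φ t (T (⨂ₜ[ℂ] i, v i (σ i b)))) (fun _ => hφ _) (fun _ => hφ _) ?_ hm d d'
  set u : E → ℂ := fun t => (φ t (T (⨂ₜ[ℂ] i, w i)) ^ (ℓ - 1))⁻¹ with hu
  set f : E → ∀ i, W i → ℂ := fun t i z => φ t (T (⨂ₜ[ℂ] j, Function.update w i z j)) with hf
  have hua : AnalyticAt ℂ u x := ((hφ _).pow _).inv (pow_ne_zero _ hw)
  have hfac : ∀ᶠ t in 𝓝 x, ∀ z : ∀ i, W i, φ t (T (⨂ₜ[ℂ] i, z i)) = u t * ∏ i, f t i (z i) := by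
    filter_upwards [hex, (hφ (T (⨂ₜ[ℂ] i, w i))).continuousAt.eventually_ne hw] with t h1 h2 z
    exact h1.eq_mul_prod h2 z
  have hfst (p : V) : AnalyticAt ℂ (fun q : E × E => φ q.1 p) (x, x) :=
    (hφ p).comp_of_eq analyticAt_fst rfl
  have hsnd (p : V) : AnalyticAt ℂ (fun q : E × E => φ q.2 p) (x, x) :=
    (hφ p).comp_of_eq analyticAt_snd rfl
  have hscal : VanishesToOrder (x, x) 0 fun q : E × E => (2 ^ ℓ)⁻¹ * (u q.1 * u q.2) :=
    analyticAt_const.fun_mul ((hua.comp_of_eq analyticAt_fst rfl).fun_mul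
      (hua.comp_of_eq analyticAt_snd rfl))
  -- Each of the `ℓ` minors vanishes on the diagonal, in particular at `(x, x)`, so their product
  -- vanishes there to order `ℓ`.
  have hprod (σ : Fin ℓ → Equiv.Perm (Fin n)) : VanishesToOrder (x, x) ℓ fun q : E × E =>
      ∏ i, (f q.1 i (v i (σ i a)) * f q.2 i (v i (σ i b)) -
        f q.1 i (v i (σ i b)) * f q.2 i (v i (σ i a))) := by
    have := VanishesToOrder.prod (x := (x, x)) (Finset.univ : Finset (Fin ℓ))
      (f := fun i q => f q.1 i (v i (σ i a)) * f q.2 i (v i (σ i b)) -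
        f q.1 i (v i (σ i b)) * f q.2 i (v i (σ i a))) fun i _ =>
      VanishesToOrder.of_eq_zero (((hfst _).fun_mul (hsnd _)).fun_sub
        ((hfst _).fun_mul (hsnd _))) (by ring)
    simpa using this
  have hsum : VanishesToOrder (x, x) ℓ fun q : E × E =>
      ∑ σ : Fin ℓ → Equiv.Perm (Fin n), hyperdetCoeff T v y a b σ *
        ∏ i, (f q.1 i (v i (σ i a)) * f q.2 i (v i (σ i b)) -
          f q.1 i (v i (σ i b)) * f q.2 i (v i (σ i a))) :=
    VanishesToOrder.sum _ fun σ _ => by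
      have hc : VanishesToOrder (x, x) 0 fun _ : E × E => hyperdetCoeff T v y a b σ :=
        analyticAt_const
      simpa only [zero_add] using hc.mul (hprod σ)
  have hall := hscal.mul hsum
  rw [zero_add] at hall
  refine hall.congr ?_
  filter_upwards [continuousAt_fst.eventually hfac, continuousAt_snd.eventually hfac] with q h1 h2
  rw [← two_pow_mul_sum_coeff T v y hab]
  simp only [h1, h2]
  rw [Finset.mul_sum, Finset.mul_sum]
  refine Finset.sum_congr rfl fun σ _ => ?_
  field_simp

lemma exists_apply_tprod_ne_zero {T : (⨂[ℂ] i, W i) →ₗ[ℂ] V} {x : Module.Dual ℂ V}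
    (h : x ∘ₗ T ≠ 0) : ∃ w : ∀ i, W i, x (T (⨂ₜ[ℂ] i, w i)) ≠ 0 := by
  by_contra! hx
  exact h (PiTensorProduct.ext (MultilinearMap.ext fun w => by simpa using hx w))

/-- A finite basis of `V` yields one neighbourhood that serves all `p`. -/
lemma eventually_forall_analyticAt [FiniteDimensional ℂ V] {E : Type*} [NormedAddCommGroup E]
    [NormedSpace ℂ E] {φ : E → Module.Dual ℂ V} {x : E}
    (hφ : ∀ p : V, AnalyticAt ℂ (fun t => φ t p) x) :
    ∀ᶠ s in 𝓝 x, ∀ p : V, AnalyticAt ℂ (fun t => φ t p) s := by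
  have B := Module.finBasis ℂ V
  filter_upwards [Filter.eventually_all.2 fun i => (hφ (B i)).eventually_analyticAt] with s hs p
  have h (t : E) : φ t p = ∑ i, B.repr p i * φ t (B i) := by
    conv_lhs => rw [← B.sum_repr p]
    simp only [map_sum, map_smul, smul_eq_mul]
  simp only [h]
  exact Finset.analyticAt_fun_sum _ fun i _ => analyticAt_const.fun_mul (hs i)

/-- Bilinearity in slots `a` and `b` reduces to partial derivatives of orders `m, m' ≤ k`, and then
`m + m' ≤ 2 * k < ℓ`. -/
lemma hyperdet_eq_zero_of_mem_osculatingCone [FiniteDimensional ℂ V] {N k : ℕ} (hk : 2 * k < ℓ)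
    (T : (⨂[ℂ] i, W i) →ₗ[ℂ] V) (v : ∀ i, Fin n → W i)
    (y : Fin n → Module.Dual ℂ V) {a b : Fin n} (hab : a ≠ b)
    {φ : (Fin N → ℂ) → Module.Dual ℂ V} (hφ : ∀ p : V, AnalyticAt ℂ (fun t => φ t p) 0)
    (hex : ∀ᶠ t in 𝓝 0, SatisfiesExchange T (φ t)) (ha : y a ∈ osculatingCone k φ)
    (hb : y b ∈ osculatingCone k φ) : hyperdet T v y = 0 := by
  rw [hyperdet_eq_sum_coeff T v y hab]
  suffices h : ∀ x ∈ osculatingCone k φ, ∀ z ∈ osculatingCone k φ,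
      ∑ σ : Fin ℓ → Equiv.Perm (Fin n), hyperdetCoeff T v y a b σ *
        (x (T (⨂ₜ[ℂ] i, v i (σ i a))) * z (T (⨂ₜ[ℂ] i, v i (σ i b)))) = 0 from h _ ha _ hb
  intro x ha z hb
  induction ha using Submodule.span_induction with
  | zero => simp
  | add x x' _ _ h h' =>
    simp only [LinearMap.add_apply, add_mul, mul_add, Finset.sum_add_distrib, h, h', add_zero]
  | smul r x _ h =>
    simp only [LinearMap.smul_apply, smul_eq_mul, mul_assoc, mul_left_comm _ r,
      ← Finset.mul_sum, h, mul_zero]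
  | mem x hx =>
    obtain ⟨m, hm, d, hx⟩ := hx
    induction hb using Submodule.span_induction with
    | zero => simp
    | add x x' _ _ h h' =>
      simp only [LinearMap.add_apply, mul_add, Finset.sum_add_distrib, h, h', add_zero]
    | smul r x _ h =>
      simp only [LinearMap.smul_apply, smul_eq_mul, mul_left_comm _ r,
        ← Finset.mul_sum, h, mul_zero]
    | mem z hz =>
      obtain ⟨m', hm', d', hz⟩ := hz
      simp only [hx, hz]
      by_cases h0 : ∀ᶠ t in 𝓝 0, φ t ∘ₗ T = 0
      · refine Finset.sum_eq_zero fun σ _ => ?_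
        have h1 : (fun t => φ t (T (⨂ₜ[ℂ] i, v i (σ i a)))) =ᶠ[𝓝 0] fun _ => 0 := by
          filter_upwards [h0] with t ht
          exact LinearMap.congr_fun ht _
        rw [(h1.iteratedFDeriv ℂ m).eq_of_nhds]
        simp
      -- `T*φ(0)` itself may be zero. A nonzero sum of derivatives at `0` would stay nonzero nearby,
      -- but it vanishes at every nearby `t` with `T*φ(t) ≠ 0`; so `T*φ` would vanish near `0`,
      -- against `h0`.
      · rw [Filter.not_eventually] at h0
        by_contra hne
        refine h0 ?_
        have hcont : ContinuousAt (fun s => ∑ σ : Fin ℓ → Equiv.Perm (Fin n),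
            hyperdetCoeff T v y a b σ *
            (iteratedFDeriv ℂ m (fun t => φ t (T (⨂ₜ[ℂ] i, v i (σ i a)))) s
                (fun j => Pi.single (d j) 1) *
              iteratedFDeriv ℂ m' (fun t => φ t (T (⨂ₜ[ℂ] i, v i (σ i b)))) s
                fun j => Pi.single (d' j) 1)) 0 :=
          tendsto_finsetSum _ fun σ _ => continuousAt_const.mul
            ((continuousAt_iteratedFDeriv_apply (hφ _) _ _).mul
              (continuousAt_iteratedFDeriv_apply (hφ _) _ _))
        filter_upwards [hcont.eventually_ne hne, eventually_forall_analyticAt hφ,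
          hex.eventually_nhds] with t h1 h2 h3 h4
        obtain ⟨w, hw⟩ := exists_apply_tprod_ne_zero h4
        exact h1 (sum_coeff_iteratedFDeriv_eq_zero T v y hab h2 h3 hw (by omega) _ _)

end Hyperdeterminant

/-! ### Forms and the Zariski topology -/

section Forms

variable {V : Type*} [AddCommGroup V] [Module ℂ V]

lemma prod_ι_mem_forms {d : ℕ} (s : Fin d → V) :
    ∏ j, SymmetricAlgebra.ι ℂ V (s j) ∈ forms V d := by
  induction d with
  | zero => simp [forms]
  | succ d ih =>
    rw [Fin.prod_univ_succ, forms, pow_succ']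
    exact Submodule.mul_mem_mul (LinearMap.mem_range_self _ _) (ih _)

lemma evalAt_ι (x : Module.Dual ℂ V) (v : V) : evalAt x (SymmetricAlgebra.ι ℂ V v) = x v := by
  simp [evalAt]

lemma evalAt_smul {d : ℕ} {f : SymmetricAlgebra ℂ V} (hf : f ∈ forms V d) (c : ℂ)
    (x : Module.Dual ℂ V) : evalAt (c • x) f = c ^ d * evalAt x f := by
  induction d generalizing f with
  | zero =>
    rw [forms, pow_zero, Submodule.mem_one] at hf
    obtain ⟨r, rfl⟩ := hf
    simp
  | succ d ih =>
    rw [forms, pow_succ'] at hf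
    induction hf using Submodule.mul_induction_on' with
    | mem_mul_mem g hg h hh =>
      obtain ⟨v, rfl⟩ := hg
      rw [map_mul, map_mul, ih hh, evalAt_ι, evalAt_ι, LinearMap.smul_apply, smul_eq_mul]
      ring
    | add a _ b _ ha hb => rw [map_add, map_add, ha, hb, mul_add]

lemma evalAt_mk_rep_eq_zero_iff {d : ℕ} {f : SymmetricAlgebra ℂ V} (hf : f ∈ forms V d)
    {x : Module.Dual ℂ V} (hx : x ≠ 0) :
    evalAt (Projectivization.mk ℂ x hx).rep f = 0 ↔ evalAt x f = 0 := by
  obtain ⟨a, ha⟩ := Projectivization.exists_smul_eq_mk_rep ℂ x hx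
  rw [← ha, Units.smul_def, evalAt_smul hf]
  simp

lemma isOpen_setOf_evalAt_ne_zero {d : ℕ} {f : SymmetricAlgebra ℂ V} (hf : f ∈ forms V d) :
    IsOpen {p : PP V | evalAt p.rep f ≠ 0} :=
  TopologicalSpace.isOpen_generateFrom_of_mem ⟨d, f, hf, rfl⟩

lemma mem_vanishingIdeal_closure {d : ℕ} (hd : d ≠ 0) {f : SymmetricAlgebra ℂ V}
    (hf : f ∈ forms V d) {S : Set (PP V)} (h : ∀ p ∈ S, evalAt p.rep f = 0) :
    f ∈ vanishingIdeal (closure S) := by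
  intro x hx
  by_cases h0 : x = 0
  -- The affine cone always contains the origin, where a form vanishes because its degree is
  -- positive.
  · have := evalAt_smul hf 0 x
    rwa [zero_smul, zero_pow hd, zero_mul, ← h0] at this
  · have hcl : IsClosed {p : PP V | evalAt p.rep f = 0} := by
      simpa [← isOpen_compl_iff, Set.compl_ofPred] using isOpen_setOf_evalAt_ne_zero hf
    exact (evalAt_mk_rep_eq_zero_iff hf h0).1 (closure_minimal h hcl (hx h0))

end Forms

/-! ### Rank one on the whole cone, and vanishing on spans of osculating spaces -/

section Multiplicative

open PiTensorProduct

variable {V : Type*} [AddCommGroup V] [Module ℂ V]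
variable {ℓ : ℕ} {W : Fin ℓ → Type*} [∀ i, AddCommGroup (W i)] [∀ i, Module ℂ (W i)]

/-- For fixed `v` and `w` the identity is the vanishing of a form of degree `ℓ`. Its nonvanishing
locus, if it met `X`, would by irreducibility meet `U ∩ X`, where `T*` is simple or zero. -/
lemma IsSimpleOn.satisfiesExchange (hℓ : ℓ ≠ 0) {X : Set (PP V)} (hX : IsIrreducible X)
    {T : (⨂[ℂ] i, W i) →ₗ[ℂ] V} (hT : IsSimpleOn X T) {x : Module.Dual ℂ V}
    (hx : x ∈ affineCone X) : SatisfiesExchange T x := by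
  by_cases h0 : x = 0
  · exact .of_comp_eq_zero hℓ (by rw [h0, LinearMap.zero_comp])
  obtain ⟨U, hU, ⟨p₀, hp₀U, hp₀X⟩, hsimple⟩ := hT
  intro v w
  set f : SymmetricAlgebra ℂ V :=
    SymmetricAlgebra.ι ℂ V (T (⨂ₜ[ℂ] i, v i)) * SymmetricAlgebra.ι ℂ V (T (⨂ₜ[ℂ] i, w i)) ^ (ℓ - 1) -
      ∏ i, SymmetricAlgebra.ι ℂ V (T (⨂ₜ[ℂ] j, Function.update w i (v i) j)) with hf
  have heval (z : Module.Dual ℂ V) : evalAt z f =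
      z (T (⨂ₜ[ℂ] i, v i)) * z (T (⨂ₜ[ℂ] i, w i)) ^ (ℓ - 1) -
        ∏ i, z (T (⨂ₜ[ℂ] j, Function.update w i (v i) j)) := by
    simp only [hf, map_sub, map_mul, map_pow, map_prod, evalAt_ι]
  have hmem : f ∈ forms V ℓ := by
    refine Submodule.sub_mem _ ?_ (prod_ι_mem_forms _)
    have hpow : forms V ℓ = LinearMap.range (SymmetricAlgebra.ι ℂ V) *
        LinearMap.range (SymmetricAlgebra.ι ℂ V) ^ (ℓ - 1) := (mul_pow_sub_one hℓ _).symm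
    rw [hpow]
    exact Submodule.mul_mem_mul (LinearMap.mem_range_self _ _)
      (Submodule.pow_mem_pow _ (LinearMap.mem_range_self _ _) _)
  by_contra hne
  rw [← sub_eq_zero, ← heval, ← evalAt_mk_rep_eq_zero_iff hmem h0] at hne
  obtain ⟨p, hpX, hpf, hpU⟩ := hX.2 _ U (isOpen_setOf_evalAt_ne_zero hmem) hU
    ⟨_, hx h0, hne⟩ ⟨p₀, hp₀X, hp₀U⟩
  refine hpf ?_
  have hp : SatisfiesExchange T p.rep := by
    rcases hsimple p.rep p.rep_nonzero (by rw [Projectivization.mk_rep]; exact ⟨hpU, hpX⟩)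
      with h | h
    · exact .of_isSimpleTensor h
    · exact .of_comp_eq_zero hℓ h
  rw [heval, hp v w, sub_self]

lemma range_bMap_le {n : ℕ} {T : (⨂[ℂ] i, W i) →ₗ[ℂ] V} {P : Submodule ℂ (SymmetricAlgebra ℂ V)}
    (h : ∀ v : ∀ i, Fin n → W i, bMap n T (⨂ₜ[ℂ] i, exteriorPower.ιMulti ℂ n (v i)) ∈ P) :
    LinearMap.range (bMap n T) ≤ P := by
  rw [LinearMap.range_eq_map, ← submodule_span_eq_top (R := ℂ) (M := fun i => ⋀[ℂ]^n (W i))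
    (g := fun i (v : Fin n → W i) => exteriorPower.ιMulti ℂ n v)
    fun i => exteriorPower.ιMulti_span ℂ n (W i), Submodule.map_span_le]
  rintro _ ⟨v, rfl⟩
  exact h v

lemma bMap_tprod_mem_forms {n : ℕ} (T : (⨂[ℂ] i, W i) →ₗ[ℂ] V) (v : ∀ i, Fin n → W i) :
    bMap n T (⨂ₜ[ℂ] i, exteriorPower.ιMulti ℂ n (v i)) ∈ forms V n := by
  simp only [bMap, LinearMap.comp_apply, canonicalMap_tprod, AlgHom.toLinearMap_apply, map_smul,
    map_sum, map_prod, SymmetricAlgebra.lift_ι_apply]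
  exact Submodule.smul_mem _ _ (Submodule.sum_mem _ fun σ _ =>
    Submodule.smul_mem _ _ (prod_ι_mem_forms _))

lemma hyperdet_eq_zero_of_mem_osculatingSpan [FiniteDimensional ℂ V] {N k q n : ℕ}
    (hk : 2 * k < ℓ) (hqn : q < n) (T : (⨂[ℂ] i, W i) →ₗ[ℂ] V) (v : ∀ i, Fin n → W i)
    {φ : Fin q → (Fin N → ℂ) → Module.Dual ℂ V}
    (hφ : ∀ (j : Fin q) (p : V), AnalyticAt ℂ (fun t => φ j t p) 0)
    (hex : ∀ j, ∀ᶠ t in 𝓝 0, SatisfiesExchange T (φ j t)) {x : Module.Dual ℂ V}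
    (hx : x ∈ osculatingSpan k φ) : hyperdet T v (fun _ => x) = 0 := by
  have hx' : x ∈ ⨆ j ∈ (Finset.univ : Finset (Fin q)), osculatingCone k (φ j) := by
    simpa [osculatingSpan] using hx
  obtain ⟨μ, rfl⟩ := (Submodule.mem_iSup_finset_iff_exists_sum _ _).1 hx'
  rw [MultilinearMap.map_sum (hyperdet T v) fun _ j => (μ j : Module.Dual ℂ V)]
  refine Finset.sum_eq_zero fun r _ => ?_
  -- Pigeonhole: `n > q` slots are filled from only `q` osculating cones.
  obtain ⟨a, b, hab, hr⟩ := Fintype.exists_ne_map_eq_of_card_lt r (by simpa using hqn)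
  exact hyperdet_eq_zero_of_mem_osculatingCone hk T v _ hab (hφ (r a)) (hex (r a)) (μ (r a)).2
    (by rw [hr]; exact (μ (r b)).2)

/-! ### Nonvanishing -/

lemma IsNondegenerate.exists_apply_ne_zero {X : Set (PP V)} (hX : IsNondegenerate X) {p : V}
    (hp : p ≠ 0) : ∃ x ∈ affineCone X, x p ≠ 0 := by
  by_contra! h
  refine hp ((Module.forall_dual_apply_eq_zero_iff ℂ p).1 fun x => ?_)
  have hle : Submodule.span ℂ (affineCone X) ≤ LinearMap.ker (Module.Dual.eval ℂ V p) :=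
    Submodule.span_le.2 fun x hx => h x hx
  rw [hX] at hle
  exact hle Submodule.mem_top

/-- Greedy choice: the new vectors are killed by all conditions from earlier points, and a new point
is then chosen where they do not vanish. Values at indices `≥ m` are arbitrary and get overwritten
in the induction. -/
lemma exists_triangular [∀ i, FiniteDimensional ℂ (W i)] {X : Set (PP V)}
    (hX : IsNondegenerate X) {T : (⨂[ℂ] i, W i) →ₗ[ℂ] V} (hT : IsOneGeneric T) (m : ℕ)
    (hm : ∀ i, m ≤ Module.finrank ℂ (W i)) :
    ∃ (x : ℕ → Module.Dual ℂ V) (w : ℕ → ∀ i, W i), ∀ j < m, x j ∈ affineCone X ∧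
      x j (T (⨂ₜ[ℂ] i, w j i)) ≠ 0 ∧
      ∀ j' < j, ∀ i, x j' (T (⨂ₜ[ℂ] l, Function.update (w j') i (w j i) l)) = 0 := by
  induction m with
  | zero => exact ⟨0, 0, by simp⟩
  | succ m ih =>
    obtain ⟨x, w, h⟩ := ih fun i => (Nat.le_succ m).trans (hm i)
    have hz (i : Fin ℓ) : ∃ z : W i, z ≠ 0 ∧
        ∀ j < m, x j (T (⨂ₜ[ℂ] l, Function.update (w j) i z l)) = 0 := by
      -- The earlier points impose `m` linear conditions on `W i`, whose dimension is at least `m +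
      -- 1`.
      have hker := LinearMap.ker_ne_bot_of_finrank_lt (f := LinearMap.pi fun j : Fin m =>
        x j ∘ₗ T ∘ₗ (PiTensorProduct.tprod ℂ).toLinearMap (w j) i) (by simpa using hm i)
      obtain ⟨z, hz, hz0⟩ := Submodule.exists_mem_ne_zero_of_ne_bot hker
      exact ⟨z, hz0, fun j hj => congrFun (LinearMap.mem_ker.1 hz) ⟨j, hj⟩⟩
    choose z hz0 hz using hz
    -- 1-genericity makes `T` nonzero on the tensor product of the `z i`, and nondegeneracy gives a
    -- point of the cone that detects it.
    obtain ⟨x₀, hx₀, hx₀z⟩ := hX.exists_apply_ne_zero (hT z hz0)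
    refine ⟨Function.update x m x₀, Function.update w m z, fun j hj => ?_⟩
    rcases Nat.lt_succ_iff_lt_or_eq.1 hj with hj | rfl
    · simp only [Function.update_of_ne hj.ne]
      refine ⟨(h j hj).1, (h j hj).2.1, fun j' hj' i => ?_⟩
      simp only [Function.update_of_ne (hj'.trans hj).ne]
      exact (h j hj).2.2 j' hj' i
    · simp only [Function.update_self]
      refine ⟨hx₀, hx₀z, fun j' hj' i => ?_⟩
      simp only [Function.update_of_ne hj'.ne]
      exact hz i j' hj'

lemma hyperdet_sum_ne_zero {n : ℕ} (hℓ : Even ℓ) (hℓ0 : ℓ ≠ 0) (T : (⨂[ℂ] i, W i) →ₗ[ℂ] V)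
    (x : Fin n → Module.Dual ℂ V) (w : Fin n → ∀ i, W i) (hex : ∀ j, SatisfiesExchange T (x j))
    (hne : ∀ j, x j (T (⨂ₜ[ℂ] i, w j i)) ≠ 0)
    (htri : ∀ j, ∀ j' < j, ∀ i, x j' (T (⨂ₜ[ℂ] l, Function.update (w j') i (w j i) l)) = 0) :
    hyperdet T (fun i j => w j i) (fun _ => ∑ j, x j) ≠ 0 := by
  classical
  set u : Fin n → ℂ := fun j => (x j (T (⨂ₜ[ℂ] i, w j i)) ^ (ℓ - 1))⁻¹ with hu
  set M : Fin ℓ → Matrix (Fin n) (Fin n) ℂ := fun i =>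
    Matrix.of fun p j => x j (T (⨂ₜ[ℂ] l, Function.update (w j) i (w p i) l)) with hM
  have hdet (i : Fin ℓ) : (M i).det ≠ 0 := by
    rw [Matrix.det_of_isUpperTriangular (M := M i) fun p j hpj => htri p j hpj i]
    refine Finset.prod_ne_zero_iff.2 fun j _ => ?_
    simpa [hM] using hne j
  have hr (r : Fin n → Fin n) : hyperdet T (fun i j => w j i) (fun j => x (r j)) =
      (∏ j, u (r j)) * ∏ i, ((M i).submatrix id r).det :=
    hyperdet_of_simple T _ _ (fun j => u (r j))
      (fun j i z => x (r j) (T (⨂ₜ[ℂ] l, Function.update (w (r j)) i z l)))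
      fun j v => (hex (r j)).eq_mul_prod (hne (r j)) v
  have hite (r : Fin n → Fin n) : hyperdet T (fun i j => w j i) (fun j => x (r j)) =
      if Function.Bijective r then (∏ j, u j) * ∏ i, (M i).det else 0 := by
    rw [hr]
    split_ifs with hb
    · obtain ⟨π, rfl⟩ : ∃ π : Equiv.Perm (Fin n), ⇑π = r := ⟨Equiv.ofBijective r hb, rfl⟩
      rw [Equiv.prod_comp π u]
      simp only [Matrix.det_permute', Finset.prod_mul_distrib, Finset.prod_const,
        Finset.card_univ, Fintype.card_fin]
      -- Each of the `ℓ` determinants acquires the sign of `π`, and an even power of it is `1`.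
      rcases Int.units_eq_one_or (Equiv.Perm.sign π) with h | h <;> simp [h, hℓ.neg_one_pow]
    · have hinj : ¬ Function.Injective r := fun h => hb (Finite.injective_iff_bijective.1 h)
      simp only [Function.Injective, not_forall] at hinj
      obtain ⟨a, b, hab, hne'⟩ := hinj
      -- A repeated point gives a repeated column in every matrix; one vanishing determinant
      -- suffices, and one exists because `ℓ ≠ 0`.
      have h0 : ((M ⟨0, by omega⟩).submatrix id r).det = 0 :=
        Matrix.det_zero_of_column_eq hne' fun p => by simp [hab]
      rw [Finset.prod_eq_zero (Finset.mem_univ (⟨0, by omega⟩ : Fin ℓ)) h0, mul_zero]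
  rw [MultilinearMap.map_sum (hyperdet T fun i j => w j i) fun _ j => x j]
  simp only [hite]
  -- What remains is the number of bijections, positive because of the identity, times one nonzero
  -- product.
  rw [Finset.sum_ite, Finset.sum_const_zero, add_zero, Finset.sum_const, nsmul_eq_mul]
  refine mul_ne_zero (Nat.cast_ne_zero.2 (Finset.card_ne_zero_of_mem (a := id) ?_))
    (mul_ne_zero (Finset.prod_ne_zero_iff.2 fun j _ => inv_ne_zero (pow_ne_zero _ (hne j)))
      (Finset.prod_ne_zero_iff.2 fun i _ => hdet i))
  exact Finset.mem_filter.2 ⟨Finset.mem_univ _, Function.bijective_id⟩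

end Multiplicative

end SecOsc

/-! ### The main theorem -/

theorem theorem1p1 {V : Type*} [AddCommGroup V] [Module ℂ V] [FiniteDimensional ℂ V]
    (X : Set (SecOsc.PP V)) (hX : SecOsc.IsProjectiveVariety X)
    (hX' : SecOsc.IsNondegenerate X) (k : ℕ)
    (W : Fin (2 * k + 2) → Type*) [∀ i, AddCommGroup (W i)] [∀ i, Module ℂ (W i)]
    [∀ i, FiniteDimensional ℂ (W i)]
    (T : (⨂[ℂ] i, W i) →ₗ[ℂ] V) (hT : SecOsc.IsMultiplicative X T)
    (q : ℕ) (hq : 1 ≤ q) :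
    LinearMap.range (SecOsc.bMap (q + 1) T) ≤
        SecOsc.idealDegree (SecOsc.secantOsculating X q k) (q + 1) ∧
      ((∀ i, q + 1 ≤ Module.finrank ℂ (W i)) → SecOsc.bMap (q + 1) T ≠ 0) := by
  have hex {x : Module.Dual ℂ V} (hx : x ∈ SecOsc.affineCone X) : SecOsc.SatisfiesExchange T x :=
    hT.2.satisfiesExchange (by omega) hX.2 hx
  refine ⟨SecOsc.range_bMap_le fun v => ⟨?_, SecOsc.bMap_tprod_mem_forms T v⟩, fun hdim h0 => ?_⟩
  · refine SecOsc.mem_vanishingIdeal_closure (Nat.succ_ne_zero q)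
      (SecOsc.bMap_tprod_mem_forms T v) ?_
    rintro p ⟨N, φ, hφ, -, hp⟩
    rw [SecOsc.evalAt_bMap_tprod, SecOsc.hyperdet_eq_zero_of_mem_osculatingSpan (by omega)
      (Nat.lt_succ_self q) T v (fun j => (hφ j).choose_spec.2.holomorphic)
      (fun j => (hφ j).choose_spec.2.mem_cone.mono fun t ht => hex ht) hp, mul_zero]
  · obtain ⟨x, w, h⟩ := SecOsc.exists_triangular hX' hT.1 (q + 1) hdim
    -- The witness `k + 1` shows that `2 * k + 2` is even.
    have hne := SecOsc.hyperdet_sum_ne_zero (n := q + 1) ⟨k + 1, by omega⟩ (by omega) T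
      (fun j => x j) (fun j => w j) (fun j => hex (h j j.2).1) (fun j => (h j j.2).2.1)
      fun j j' hj i => (h j j.2).2.2 j' hj i
    have heval := SecOsc.evalAt_bMap_tprod T (fun i (j : Fin (q + 1)) => w j i)
      (∑ j : Fin (q + 1), x j)
    rw [h0, LinearMap.zero_apply, map_zero] at heval
    exact mul_ne_zero (inv_ne_zero (Nat.cast_ne_zero.2 (Nat.factorial_ne_zero _))) hne heval.symm
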